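/- Let $X_1,X_2,\dots$ be i.i.d. real random variables with distribution function $F_0$, mean $\mu_0$ and finite variance $\sigma_0^2$, and let $Y_1,Y_2,\dots$ be i.i.d. real random variables, independent of $(X_i)$, with distribution function $F_1$, mean $\mu_1$, variance $\sigma_1^2>0$ ($\sigma_1>0$) and $E|Y_1|^3<\infty$. For positive integers $n,k$ let $$\Delta_{n,+k}=\frac1{n+k}\Big(\sum_{i=1}^nX_i+\sum_{j=1}^kY_j\Big)-\frac1n\sum_{i=1}^nX_i$$ be the change of the mean of the sample $X_1,\dots,X_n$ when the $k$ new observations $Y_1,\dots,Y_k$ are added to it, and let $F_+$ be the distribution function of $\Delta_{n,+k}$. Let $\Phi$ be the standard normal distribution function. Let $\alpha\in(0,1)$, let $k=k(n)$ be integers with $k(n)\sim n^\alpha$, i.e. $k(n)/n^\alpha\to1$ as $n\to\infty$, and put $\beta=\min\big(\tfrac\alpha2,1-\alpha\big)$. Then, as $n\to\infty$, $$F_+\Big(\frac{\sqrt k\,\sigma_1x}{n}\Big)=\Phi\Big(x-\frac n{n+k}\,\frac{\sqrt k(\mu_1-\mu_0)}{\sigma_1}\Big)+\mathcal O(n^{-\beta})$$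 uniformly in $x\in\mathbb R$. If moreover $\mu_1\neq\mu_0$, then for every $M>0$, $$F_+\Big(\frac{\sqrt k\,\sigma_1x}{n}\Big)=\Phi\Big(x-\frac{\sqrt k(\mu_1-\mu_0)}{\sigma_1}\Big)+\mathcal O(n^{-\beta})$$ uniformly in $|x|\le M$. -/

import Mathlib

open MeasureTheory ProbabilityTheory Filter Topology Asymptotics

noncomputable section

/-- Mean of the first `n` observations `X 0, …, X (n - 1)`. -/
def sampleMean {Ω : Type*} (X : ℕ → Ω → ℝ) (n : ℕ) (ω : Ω) : ℝ :=
  (∑ i ∈ Finset.range n, X i ω) / (n : ℝ)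

/-- Mean of the enlarged sample of size `n + k`, made of the first `n` observations
`X 0, …, X (n - 1)` followed by the `k` new observations `Y 0, …, Y (k - 1)`. -/
def enlargedMean {Ω : Type*} (X Y : ℕ → Ω → ℝ) (n k : ℕ) (ω : Ω) : ℝ :=
  (∑ i ∈ Finset.range n, X i ω + ∑ j ∈ Finset.range k, Y j ω) / ((n : ℝ) + (k : ℝ))

/-- The change of the sample mean caused by adding the `k` new observations. -/
def deltaPlus {Ω : Type*} (X Y : ℕ → Ω → ℝ) (n k : ℕ) (ω : Ω) : ℝ :=
  enlargedMean X Y n k ω - sampleMean X n ω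

/-- The distribution function of `deltaPlus X Y n k` under `P`. -/
def Fplus {Ω : Type*} [MeasurableSpace Ω] (P : Measure Ω) (X Y : ℕ → Ω → ℝ) (n k : ℕ)
    (x : ℝ) : ℝ :=
  cdf (P.map (deltaPlus X Y n k)) x

/-- The standard normal distribution function. -/
def stdNormalCDF (x : ℝ) : ℝ := cdf (gaussianReal 0 1) x

end

/-! Up to the factor `σ₁ / (n + k)`, `deltaPlus` is the sum of the `k` standardized `Y`s, an
independent centred term `W` built from the `X`s, of variance at most of order `k ^ 2 / n`, and a
constant. Its law is compared with a normal law of variance `k`. Berry–Esseen costs `O(1 / √k)`;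
since the normal distribution function has second derivative `O(1 / k)`, adding `W` costs `O(k / n)`
(`abs_cdf_iterConv_conv_sub_le`). Normalizing by `n` instead of `n + k` rescales the argument by `1
+ k / n`, again `O(k / n)` (`abs_stdNormalCDF_mul_sub_le`). For `k ~ n ^ α` these are the two
exponents in `β`. If `μ₁ ≠ μ₀`, the drift tends to infinity, and for bounded `x` the decay of the
normal density pays for replacing `n / (n + k)` by `1`.

Berry–Esseen (`exists_abs_normalGap_le`) is proved without characteristic functions, by strong
induction on the number of summands. After smoothing with a normal law of fixed variance `q + 1`,
summands are exchanged for normal ones by Lindeberg's method. An exchange under smoothing variance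
`t` costs `t ^ (-3/2)` times the sup of an earlier gap. Inserting the induction hypothesis returns
`K / √n` with a factor `O(1 / √q)`, small for large `q`, and `abs_sub_le_of_abs_convAvg_le` removes
the smoothing. -/

/-- The average of the translates of `f` with respect to `ν`: the convolution of `f` with the
measure `ν`. -/
noncomputable def convAvg (ν : Measure ℝ) (f : ℝ → ℝ) (x : ℝ) : ℝ := ∫ y, f (x - y) ∂ν

/-! ### Convolution calculus for bounded functions -/

section ConvAvg

variable {ν ρ : Measure ℝ} [IsProbabilityMeasure ν] [IsProbabilityMeasure ρ] {f g : ℝ → ℝ}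
  {M N : ℝ}

lemma integrable_comp_const_sub (hf : Measurable f) (hM : ∀ x, |f x| ≤ M) (x : ℝ) :
    Integrable (fun y => f (x - y)) ν :=
  Integrable.of_bound (hf.comp (by fun_prop)).aestronglyMeasurable M (ae_of_all _ fun y => hM _)

lemma measurable_convAvg (hf : Measurable f) : Measurable (convAvg ν f) := by
  have h : StronglyMeasurable (fun p : ℝ × ℝ => f (p.1 - p.2)) :=
    (hf.comp (by fun_prop)).stronglyMeasurable
  exact h.integral_prod_right.measurable

lemma abs_convAvg_le (hM : ∀ x, |f x| ≤ M) (x : ℝ) : |convAvg ν f x| ≤ M := by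
  have := norm_integral_le_of_norm_le_const (μ := ν) (f := fun y => f (x - y)) (C := M)
    (ae_of_all _ fun y => hM _)
  simpa [convAvg] using this

lemma convAvg_sub (hf : Measurable f) (hM : ∀ x, |f x| ≤ M) (hg : Measurable g)
    (hN : ∀ x, |g x| ≤ N) (x : ℝ) :
    convAvg ν (fun y => f y - g y) x = convAvg ν f x - convAvg ν g x :=
  integral_sub (integrable_comp_const_sub hf hM x) (integrable_comp_const_sub hg hN x)

lemma convAvg_conv (hf : Measurable f) (hM : ∀ x, |f x| ≤ M) (x : ℝ) :
    convAvg (ν ∗ ρ) f x = convAvg ν (convAvg ρ f) x := by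
  unfold convAvg
  rw [integral_conv (integrable_comp_const_sub hf hM x)]
  simp only [sub_sub]

lemma convAvg_comm (hf : Measurable f) (hM : ∀ x, |f x| ≤ M) (x : ℝ) :
    convAvg ν (convAvg ρ f) x = convAvg ρ (convAvg ν f) x := by
  rw [← convAvg_conv hf hM, Measure.conv_comm, convAvg_conv hf hM]

lemma measurable_cdf (ν : Measure ℝ) : Measurable (cdf ν) := (monotone_cdf ν).measurable

lemma abs_cdf_le_one (ν : Measure ℝ) (x : ℝ) : |cdf ν x| ≤ 1 :=
  abs_le.2 ⟨by linarith [cdf_nonneg ν x], cdf_le_one ν x⟩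

lemma abs_cdf_sub_cdf_le_one (ν ρ : Measure ℝ) (x : ℝ) : |cdf ν x - cdf ρ x| ≤ 1 :=
  abs_le.2 ⟨by linarith [cdf_nonneg ν x, cdf_le_one ρ x],
    by linarith [cdf_nonneg ρ x, cdf_le_one ν x]⟩

/-- A distribution function is its law convolved with the Heaviside function, so this is
associativity of convolution. -/
lemma cdf_conv (x : ℝ) : cdf (ν ∗ ρ) x = convAvg ν (cdf ρ) x := by
  have h (η : Measure ℝ) [IsProbabilityMeasure η] (x : ℝ) :
      cdf η x = convAvg η (Set.indicator (Set.Ici 0) 1) x := by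
    rw [cdf_eq_real, ← integral_indicator_one measurableSet_Iic]
    refine integral_congr_ae (ae_of_all _ fun y => ?_)
    simp [Set.indicator_apply]
  have e : (cdf ρ : ℝ → ℝ) = convAvg ρ (Set.indicator (Set.Ici 0) 1) := funext fun x => h ρ x
  rw [h, e, convAvg_conv (M := 1) (measurable_one.indicator measurableSet_Ici)]
  intro x
  simp only [Set.indicator_apply]
  split_ifs <;> simp

lemma gaussianReal_zero_conv (s t : NNReal) :
    gaussianReal 0 s ∗ gaussianReal 0 t = gaussianReal 0 (s + t) := by
  simp [gaussianReal_conv_gaussianReal]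

end ConvAvg

/-! ### Differentiation of convolutions with a decaying kernel -/

section Kernel

variable {g K K' : ℝ → ℝ} {M C : ℝ}

/-- Lets a single integrable function dominate the kernel for all centres in a unit ball. -/
lemma inv_one_add_sq_le_of_abs_sub_le {u v : ℝ} (h : |u - v| ≤ 1) :
    (1 + u ^ 2)⁻¹ ≤ 3 * (1 + v ^ 2)⁻¹ := by
  rw [← div_eq_mul_inv, inv_le_iff_one_le_mul₀ (by positivity), div_mul_eq_mul_div,
    one_le_div (by positivity)]
  have := abs_le.1 h
  nlinarith [sq_nonneg (2 * u - v), sq_abs (u - v), sq_nonneg (u - v), abs_nonneg (u - v)]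

lemma integrable_inv_one_add_sq_sub (v : ℝ) :
    Integrable (fun z : ℝ => (1 + (v - z) ^ 2)⁻¹) :=
  integrable_inv_one_add_sq.comp_sub_left v

lemma integrable_mul_kernel (hg : Measurable g) (hM : ∀ x, |g x| ≤ M) (hK : Continuous K)
    (bK : ∀ u, |K u| ≤ C * (1 + u ^ 2)⁻¹) (v : ℝ) :
    Integrable (fun z => g z * K (v - z)) := by
  refine ((integrable_inv_one_add_sq_sub v).const_mul (M * C)).mono'
    (hg.mul (by fun_prop)).aestronglyMeasurable (ae_of_all _ fun z => ?_)
  rw [Real.norm_eq_abs, abs_mul, mul_assoc]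
  exact mul_le_mul (hM z) (bK _) (abs_nonneg _) ((abs_nonneg _).trans (hM z))

lemma abs_integral_mul_kernel_le (hM : ∀ x, |g x| ≤ M)
    (bK : ∀ u, |K u| ≤ C * (1 + u ^ 2)⁻¹) (v : ℝ) :
    |∫ z, g z * K (v - z)| ≤ M * C * Real.pi := by
  have h := norm_integral_le_of_norm_le ((integrable_inv_one_add_sq_sub v).const_mul (M * C))
    (f := fun z => g z * K (v - z)) (ae_of_all _ fun z => by
      rw [Real.norm_eq_abs, abs_mul, mul_assoc]
      exact mul_le_mul (hM z) (bK _) (abs_nonneg _) ((abs_nonneg _).trans (hM z)))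
  rw [integral_const_mul, integral_sub_left_eq_self (fun z : ℝ => (1 + z ^ 2)⁻¹),
    integral_univ_inv_one_add_sq] at h
  exact h

/-- All derivatives fall on the kernel, so `g` need only be bounded and measurable. -/
lemma hasDerivAt_integral_mul_kernel (hg : Measurable g) (hM : ∀ x, |g x| ≤ M)
    (hK : ∀ u, HasDerivAt K (K' u) u) (hK' : Continuous K')
    (bK : ∀ u, |K u| ≤ C * (1 + u ^ 2)⁻¹) (bK' : ∀ u, |K' u| ≤ C * (1 + u ^ 2)⁻¹) (v : ℝ) :
    HasDerivAt (fun v => ∫ z, g z * K (v - z)) (∫ z, g z * K' (v - z)) v := by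
  have cK : Continuous K := continuous_iff_continuousAt.2 fun u => (hK u).continuousAt
  have hM0 : 0 ≤ M := (abs_nonneg _).trans (hM 0)
  have hC0 : 0 ≤ C := by simpa using (abs_nonneg _).trans (bK 0)
  refine (hasDerivAt_integral_of_dominated_loc_of_deriv_le
    (F := fun v z => g z * K (v - z)) (F' := fun v z => g z * K' (v - z))
    (bound := fun z => M * C * (3 * (1 + (v - z) ^ 2)⁻¹)) (Metric.ball_mem_nhds v one_pos)
    (Eventually.of_forall fun w => (hg.mul (by fun_prop)).aestronglyMeasurable)
    (integrable_mul_kernel hg hM cK bK v) (hg.mul (by fun_prop)).aestronglyMeasurable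
    (ae_of_all _ fun z w hw => ?_)
    (((integrable_inv_one_add_sq_sub v).const_mul 3).const_mul _)
    (ae_of_all _ fun z w hw => ?_)).2
  · rw [Real.norm_eq_abs, abs_mul, mul_assoc]
    refine mul_le_mul (hM z) ((bK' _).trans ?_) (abs_nonneg _) hM0
    refine mul_le_mul_of_nonneg_left (inv_one_add_sq_le_of_abs_sub_le ?_) hC0
    rw [Metric.mem_ball, Real.dist_eq] at hw
    rw [sub_sub_sub_cancel_right]
    exact hw.le
  · simpa using ((hK (w - z)).comp w ((hasDerivAt_id w).sub_const z)).const_mul (g z)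

end Kernel

/-! ### Derivative bounds for Gaussian smoothing -/

section GaussianSmoothing

/-- The cubic term of the exponential series absorbs the polynomial; `400` rounds up `4 * 2 * 48`.
The hypothesis covers the polynomial factors in the first three derivatives of the Gaussian. -/
lemma abs_mul_exp_neg_sq_le {p u : ℝ} (hp : |p| ≤ 4 * (1 + u ^ 2) ^ 2) :
    |p * Real.exp (-u ^ 2 / 2)| ≤ 400 * (1 + u ^ 2)⁻¹ := by
  rw [abs_mul, abs_of_pos (Real.exp_pos _), ← div_eq_mul_inv, le_div_iff₀ (by positivity)]
  have h1 := Real.pow_div_factorial_le_exp ((1 + u ^ 2) / 2) (by positivity) 3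
  have h2 : Real.exp (-u ^ 2 / 2) * Real.exp ((1 + u ^ 2) / 2) = Real.exp (1 / 2) := by
    rw [← Real.exp_add]; congr 1; ring
  have h3 : Real.exp (1 / 2) ≤ 2 := by
    have : Real.exp (1 / 2) * Real.exp (1 / 2) = Real.exp 1 := by rw [← Real.exp_add]; norm_num
    nlinarith [Real.exp_one_lt_d9, Real.exp_pos (1 / 2 : ℝ)]
  have h4 : Real.exp (-u ^ 2 / 2) * ((1 + u ^ 2) ^ 3 / 48) ≤ 2 := by
    refine le_trans ?_ h3
    rw [← h2]
    refine mul_le_mul_of_nonneg_left (le_trans (le_of_eq ?_) h1) (Real.exp_pos _).le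
    simp [Nat.factorial]; ring
  have h5 : |p| * Real.exp (-u ^ 2 / 2) * (1 + u ^ 2) ≤
      4 * (1 + u ^ 2) ^ 2 * Real.exp (-u ^ 2 / 2) * (1 + u ^ 2) := by gcongr
  nlinarith

lemma hasDerivAt_exp_neg_sq (u : ℝ) :
    HasDerivAt (fun u => Real.exp (-u ^ 2 / 2)) (-u * Real.exp (-u ^ 2 / 2)) u := by
  have : HasDerivAt (fun u : ℝ => -u ^ 2 / 2) (-u) u := by
    convert! ((hasDerivAt_pow 2 u).neg.div_const 2) using 1
    simp; ring
  convert! this.exp using 1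
  ring

/-- The substitution puts `x` into the kernel alone, through `x / √t`, so each derivative brings a
factor `1 / √t`. -/
lemma convAvg_gaussianReal_eq {t : NNReal} (ht : 0 < t) {g : ℝ → ℝ} (hg : Measurable g) (x : ℝ) :
    convAvg (gaussianReal 0 t) g x = ∫ z, (√(2 * Real.pi))⁻¹ * g (√t * z) *
      Real.exp (-(x / √t - z) ^ 2 / 2) := by
  have hs : 0 < √(t : ℝ) := Real.sqrt_pos.2 (by exact_mod_cast ht)
  have e : gaussianReal 0 t = (gaussianReal 0 1).map (√(t : ℝ) * ·) := by
    rw [gaussianReal_map_const_mul]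
    congr 1
    · simp
    · ext; simp
  rw [convAvg, e, integral_map (f := fun y => g (x - y)) (by fun_prop)
      (hg.comp (by fun_prop)).aestronglyMeasurable,
    integral_gaussianReal_eq_integral_smul one_ne_zero,
    ← integral_sub_left_eq_self _ _ (x / √(t : ℝ))]
  refine integral_congr_ae (ae_of_all _ fun z => ?_)
  simp only [gaussianPDFReal, smul_eq_mul]
  rw [show x - √(t : ℝ) * (x / √(t : ℝ) - z) = √(t : ℝ) * z by field_simp; ring]
  simp
  ring

/-- Gaussian smoothing of a bounded function yields a function with bounded derivatives. -/
lemma exists_hasDerivAt_convAvg_gaussianReal {t : NNReal} (ht : 0 < t) {g : ℝ → ℝ} {M : ℝ}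
    (hg : Measurable g) (hM : ∀ x, |g x| ≤ M) :
    ∃ f₁ f₂ f₃ : ℝ → ℝ, (∀ x, HasDerivAt (convAvg (gaussianReal 0 t) g) (f₁ x) x) ∧
      (∀ x, HasDerivAt f₁ (f₂ x) x) ∧ (∀ x, HasDerivAt f₂ (f₃ x) x) ∧
      (∀ x, |f₂ x| ≤ 1600 * M / t) ∧ (∀ x, |f₃ x| ≤ 1600 * M / √(t : ℝ) ^ 3) := by
  have hs : 0 < √(t : ℝ) := Real.sqrt_pos.2 (by exact_mod_cast ht)
  have hM0 : 0 ≤ M := (abs_nonneg _).trans (hM 0)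
  set s := √(t : ℝ) with hs_def
  set G : ℝ → ℝ := fun z => (√(2 * Real.pi))⁻¹ * g (s * z) with hG
  have mG : Measurable G := (hg.comp (by fun_prop)).const_mul _
  have bG : ∀ z, |G z| ≤ M := fun z => by
    rw [hG, abs_mul, abs_of_pos (by positivity)]
    have : (√(2 * Real.pi))⁻¹ ≤ 1 :=
      inv_le_one_of_one_le₀ (Real.one_le_sqrt.2 (by linarith [Real.pi_gt_three]))
    calc _ ≤ 1 * |g (s * z)| := by gcongr
      _ ≤ M := by rw [one_mul]; exact hM _
  let E : ℝ → ℝ := fun u => Real.exp (-u ^ 2 / 2)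
  let K (p : ℝ → ℝ) : ℝ → ℝ := fun u => p u * E u
  -- Differentiation sends `p` to `p' - u * p`, which generates the signed Hermite polynomials used
  -- below.
  have dK (p p' : ℝ → ℝ) (hp : ∀ u, HasDerivAt p (p' u) u) (u : ℝ) :
      HasDerivAt (K p) (K (fun u => p' u - u * p u) u) u := by
    convert! (hp u).mul (hasDerivAt_exp_neg_sq u) using 1
    simp only [K, E]; ring
  have bK0 (u : ℝ) : |K (fun _ => 1) u| ≤ 400 * (1 + u ^ 2)⁻¹ :=
    abs_mul_exp_neg_sq_le (by rw [abs_one]; nlinarith [sq_nonneg u, sq_nonneg (u ^ 2)])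
  have bK1 (u : ℝ) : |K (fun u => -u) u| ≤ 400 * (1 + u ^ 2)⁻¹ :=
    abs_mul_exp_neg_sq_le (abs_le.2
      ⟨by nlinarith [sq_nonneg (u + 1), sq_nonneg (u - 1), sq_nonneg (u ^ 2)],
        by nlinarith [sq_nonneg (u + 1), sq_nonneg (u - 1), sq_nonneg (u ^ 2)]⟩)
  have bK2 (u : ℝ) : |K (fun u => u ^ 2 - 1) u| ≤ 400 * (1 + u ^ 2)⁻¹ :=
    abs_mul_exp_neg_sq_le (abs_le.2
      ⟨by nlinarith [sq_nonneg u, sq_nonneg (u ^ 2)],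
        by nlinarith [sq_nonneg u, sq_nonneg (u ^ 2)]⟩)
  have bK3 (u : ℝ) : |K (fun u => 3 * u - u ^ 3) u| ≤ 400 * (1 + u ^ 2)⁻¹ :=
    abs_mul_exp_neg_sq_le (abs_le.2
      ⟨by nlinarith [sq_nonneg u, sq_nonneg (u ^ 2 + u), sq_nonneg (u ^ 2 - u),
          sq_nonneg (u + 1), sq_nonneg (u - 1), sq_nonneg (u ^ 2)],
        by nlinarith [sq_nonneg u, sq_nonneg (u ^ 2 + u), sq_nonneg (u ^ 2 - u),
          sq_nonneg (u + 1), sq_nonneg (u - 1), sq_nonneg (u ^ 2)]⟩)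
  have d0 (u : ℝ) : HasDerivAt (K fun _ => 1) (K (fun u => -u) u) u := by
    convert! dK (fun _ => 1) (fun _ => 0) (fun u => hasDerivAt_const u 1) u using 1
    simp [K]
  have d1 (u : ℝ) : HasDerivAt (K fun u => -u) (K (fun u => u ^ 2 - 1) u) u := by
    convert! dK (fun u => -u) (fun _ => -1) (fun u => (hasDerivAt_id u).neg) u using 1
    simp only [K]; ring
  have d2 (u : ℝ) : HasDerivAt (K fun u => u ^ 2 - 1) (K (fun u => 3 * u - u ^ 3) u) u := by
    convert! dK (fun u => u ^ 2 - 1) (fun u => 2 * u)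
      (fun u => by simpa using (hasDerivAt_pow 2 u).sub_const 1) u using 1
    simp only [K]; ring
  let H (p : ℝ → ℝ) (v : ℝ) : ℝ := ∫ z, G z * K p (v - z)
  have scale (F F' : ℝ → ℝ) (hF : ∀ v, HasDerivAt F (F' v) v) (a x : ℝ) :
      HasDerivAt (fun x => F (x / s) / a) (F' (x / s) / (a * s)) x := by
    have h := ((hF (x / s)).comp x ((hasDerivAt_id x).div_const s)).div_const a
    convert! h using 1
    field_simp
  have cE : Continuous E := by fun_prop
  have cont (p : ℝ → ℝ) (hp : Continuous p) : Continuous (K p) := hp.mul cE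
  have D0 := hasDerivAt_integral_mul_kernel mG bG d0 (cont _ (by fun_prop)) bK0 bK1
  have D1 := hasDerivAt_integral_mul_kernel mG bG d1 (cont _ (by fun_prop)) bK1 bK2
  have D2 := hasDerivAt_integral_mul_kernel mG bG d2 (cont _ (by fun_prop)) bK2 bK3
  have e0 : convAvg (gaussianReal 0 t) g = fun x => H (fun _ => 1) (x / s) / 1 := by
    ext x
    rw [convAvg_gaussianReal_eq ht hg, div_one]
    simp only [H, G, K, E, one_mul, hs_def]
  have bH (p : ℝ → ℝ) (hp : ∀ u, |K p u| ≤ 400 * (1 + u ^ 2)⁻¹) (v : ℝ) :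
      |H p v| ≤ 1600 * M := by
    refine (abs_integral_mul_kernel_le bG hp v).trans ?_
    -- `1600 = 400 * 4`, with `π ≤ 4`.
    nlinarith [Real.pi_le_four]
  refine ⟨fun x => H (fun u => -u) (x / s) / (1 * s),
    fun x => H (fun u => u ^ 2 - 1) (x / s) / (1 * s * s),
    fun x => H (fun u => 3 * u - u ^ 3) (x / s) / (1 * s * s * s), fun x => ?_,
    fun x => scale _ _ D1 _ x, fun x => scale _ _ D2 _ x, fun x => ?_, fun x => ?_⟩
  · rw [e0]; exact scale _ _ D0 _ x
  · have : (t : ℝ) = s * s := (Real.mul_self_sqrt t.2).symm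
    rw [one_mul, abs_div, abs_of_pos (a := s * s) (by positivity), this]
    gcongr
    exact bH _ bK2 _
  · rw [one_mul, abs_div, abs_of_pos (a := s * s * s) (by positivity),
      show s ^ 3 = s * s * s by ring]
    gcongr
    exact bH _ bK3 _

end GaussianSmoothing

/-! ### Taylor remainders and moment matching -/

section Taylor

variable {f f₁ f₂ f₃ : ℝ → ℝ} {B : ℝ}

/-- Mean value inequality between `0` and `y`. Not integrating the power forfeits the factorials,
which affects constants only. -/
lemma abs_le_mul_pow_of_hasDerivAt {r r' : ℝ → ℝ} {n : ℕ} (h0 : r 0 = 0)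
    (hr : ∀ y, HasDerivAt r (r' y) y) (hB : ∀ y, |r' y| ≤ B * |y| ^ n) (hB0 : 0 ≤ B) (y : ℝ) :
    |r y| ≤ B * |y| ^ (n + 1) := by
  have h := Convex.norm_image_sub_le_of_norm_hasDerivWithin_le (f := r) (f' := r')
    (s := Set.uIcc 0 y) (C := B * |y| ^ n) (x := 0) (y := y)
    (fun z _ => (hr z).hasDerivWithinAt) (fun z hz => (hB z).trans ?_)
    (convex_uIcc 0 y) Set.left_mem_uIcc Set.right_mem_uIcc
  · rw [h0, sub_zero, sub_zero] at h
    rw [pow_succ, ← mul_assoc]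
    exact h
  · have : |z| ≤ |y| := by simpa using Set.abs_sub_left_of_mem_uIcc hz
    gcongr

lemma abs_taylor_two_le (h₀ : ∀ x, HasDerivAt f (f₁ x) x) (h₁ : ∀ x, HasDerivAt f₁ (f₂ x) x)
    (hB : ∀ x, |f₂ x| ≤ B) (x y : ℝ) :
    |f (x - y) - f x + y * f₁ x| ≤ B * |y| ^ 2 := by
  have hB0 : 0 ≤ B := (abs_nonneg _).trans (hB 0)
  have hs (F F' : ℝ → ℝ) (hF : ∀ x, HasDerivAt F (F' x) x) (y : ℝ) :
      HasDerivAt (fun y => F (x - y)) (-F' (x - y)) y := by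
    simpa [Function.comp_def] using (hF (x - y)).comp y ((hasDerivAt_id y).const_sub x)
  have b1 := abs_le_mul_pow_of_hasDerivAt (B := B) (n := 0) (r := fun y => f₁ x - f₁ (x - y))
    (by simp) (fun y => (hs _ _ h₁ y).const_sub _) (by simpa using fun y => hB _) hB0
  refine abs_le_mul_pow_of_hasDerivAt (n := 1) (r := fun y => f (x - y) - f x + y * f₁ x)
    (r' := fun y => f₁ x - f₁ (x - y)) (by simp) (fun y => ?_) (by simpa using b1) hB0 y
  convert! ((hs _ _ h₀ y).sub_const (f x)).add ((hasDerivAt_id y).mul_const (f₁ x)) using 1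
  ring

lemma abs_taylor_three_le (h₀ : ∀ x, HasDerivAt f (f₁ x) x) (h₁ : ∀ x, HasDerivAt f₁ (f₂ x) x)
    (h₂ : ∀ x, HasDerivAt f₂ (f₃ x) x) (hB : ∀ x, |f₃ x| ≤ B) (x y : ℝ) :
    |f (x - y) - f x + y * f₁ x - y ^ 2 * (f₂ x / 2)| ≤ B * |y| ^ 3 := by
  have hB0 : 0 ≤ B := (abs_nonneg _).trans (hB 0)
  have hs (F F' : ℝ → ℝ) (hF : ∀ x, HasDerivAt F (F' x) x) (y : ℝ) :
      HasDerivAt (fun y => F (x - y)) (-F' (x - y)) y := by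
    simpa [Function.comp_def] using (hF (x - y)).comp y ((hasDerivAt_id y).const_sub x)
  have b1 := abs_taylor_two_le h₁ h₂ hB x
  refine abs_le_mul_pow_of_hasDerivAt (n := 2)
    (r := fun y => f (x - y) - f x + y * f₁ x - y ^ 2 * (f₂ x / 2))
    (r' := fun y => -(f₁ (x - y) - f₁ x + y * f₂ x)) (by simp) (fun y => ?_)
    (by simpa only [abs_neg] using b1) hB0 y
  convert! (((hs _ _ h₀ y).sub_const (f x)).add ((hasDerivAt_id y).mul_const (f₁ x))).sub
    ((hasDerivAt_pow 2 y).mul_const (f₂ x / 2)) using 1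
  simp
  ring

lemma integrable_abs_pow_of_memLp {ν : Measure ℝ} [IsFiniteMeasure ν] {n : ℕ}
    (h : MemLp (id : ℝ → ℝ) n ν) : Integrable (fun y => |y| ^ n) ν := by
  simpa using h.integrable_norm_pow'

lemma continuous_of_forall_hasDerivAt (h : ∀ x, HasDerivAt f (f₁ x) x) : Continuous f :=
  continuous_iff_continuousAt.2 fun x => (h x).continuousAt

/-- The linear Taylor term integrates to zero because `ν` is centred. -/
lemma abs_convAvg_sub_le {ν : Measure ℝ} [IsProbabilityMeasure ν] {M : ℝ}
    (hν : MemLp (id : ℝ → ℝ) 2 ν) (hmean : ∫ y, y ∂ν = 0) (hM : ∀ x, |f x| ≤ M)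
    (h₀ : ∀ x, HasDerivAt f (f₁ x) x) (h₁ : ∀ x, HasDerivAt f₁ (f₂ x) x)
    (hB : ∀ x, |f₂ x| ≤ B) (x : ℝ) :
    |convAvg ν f x - f x| ≤ B * ∫ y, y ^ 2 ∂ν := by
  have i1 : Integrable (fun y : ℝ => y) ν := memLp_one_iff_integrable.1 (hν.mono_exponent (by simp))
  have i2 : Integrable (fun y : ℝ => |y| ^ 2) ν := integrable_abs_pow_of_memLp (n := 2) (by simpa)
  have i0 := integrable_comp_const_sub (ν := ν) (continuous_of_forall_hasDerivAt h₀).measurable hM x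
  have e : convAvg ν f x - f x = ∫ y, (f (x - y) - f x + y * f₁ x) ∂ν := by
    rw [integral_add (f := fun y => f (x - y) - f x) (i0.sub (integrable_const _))
      (i1.mul_const _), integral_sub i0 (integrable_const _), integral_mul_const, hmean]
    simp [convAvg]
  rw [e]
  have := norm_integral_le_of_norm_le (i2.const_mul B)
    (f := fun y => f (x - y) - f x + y * f₁ x) (ae_of_all ν fun y => abs_taylor_two_le h₀ h₁ hB x y)
  rw [integral_const_mul] at this
  simpa using this

/-- Equal first and second moments cancel the expansions through order two; only cubic remainders
survive. -/
lemma abs_convAvg_sub_convAvg_le {μ ν : Measure ℝ} [IsProbabilityMeasure μ]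
    [IsProbabilityMeasure ν] {M : ℝ}
    (hμ : MemLp (id : ℝ → ℝ) 3 μ) (hν : MemLp (id : ℝ → ℝ) 3 ν)
    (hmean : ∫ y, y ∂μ = ∫ y, y ∂ν) (hsq : ∫ y, y ^ 2 ∂μ = ∫ y, y ^ 2 ∂ν)
    (hM : ∀ x, |f x| ≤ M)
    (h₀ : ∀ x, HasDerivAt f (f₁ x) x) (h₁ : ∀ x, HasDerivAt f₁ (f₂ x) x)
    (h₂ : ∀ x, HasDerivAt f₂ (f₃ x) x) (hB : ∀ x, |f₃ x| ≤ B) (x : ℝ) :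
    |convAvg μ f x - convAvg ν f x| ≤ B * (∫ y, |y| ^ 3 ∂μ + ∫ y, |y| ^ 3 ∂ν) := by
  have key (ρ : Measure ℝ) [IsProbabilityMeasure ρ] (hρ : MemLp (id : ℝ → ℝ) 3 ρ) :
      |convAvg ρ f x - f x + (∫ y, y ∂ρ) * f₁ x - (∫ y, y ^ 2 ∂ρ) * (f₂ x / 2)|
        ≤ B * ∫ y, |y| ^ 3 ∂ρ := by
    have i1 : Integrable (fun y : ℝ => y) ρ :=
      memLp_one_iff_integrable.1 (hρ.mono_exponent (by norm_num))
    have i2 : Integrable (fun y : ℝ => y ^ 2) ρ := by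
      simpa using integrable_abs_pow_of_memLp (n := 2) (hρ.mono_exponent (by norm_num))
    have i3 : Integrable (fun y : ℝ => |y| ^ 3) ρ :=
      integrable_abs_pow_of_memLp (n := 3) (by simpa)
    have i0 := integrable_comp_const_sub (ν := ρ)
      (continuous_of_forall_hasDerivAt h₀).measurable hM x
    have e : convAvg ρ f x - f x + (∫ y, y ∂ρ) * f₁ x - (∫ y, y ^ 2 ∂ρ) * (f₂ x / 2)
        = ∫ y, (f (x - y) - f x + y * f₁ x - y ^ 2 * (f₂ x / 2)) ∂ρ := by
      rw [integral_sub (f := fun y => f (x - y) - f x + y * f₁ x)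
          ((i0.sub (integrable_const _)).add (i1.mul_const _)) (i2.mul_const _),
        integral_add (f := fun y => f (x - y) - f x) (i0.sub (integrable_const _))
          (i1.mul_const _),
        integral_sub i0 (integrable_const _), integral_mul_const, integral_mul_const]
      simp [convAvg]
    rw [e, ← integral_const_mul]
    exact norm_integral_le_of_norm_le (i3.const_mul B)
      (f := fun y => f (x - y) - f x + y * f₁ x - y ^ 2 * (f₂ x / 2)) (ae_of_all ρ fun y => abs_taylor_three_le h₀ h₁ h₂ hB x y)
  have k1 := abs_le.1 (key μ hμ)
  have k2 := abs_le.1 (key ν hν)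
  rw [hmean, hsq] at k1
  rw [abs_le]
  constructor <;> linarith [k1.1, k1.2, k2.1, k2.2]

end Taylor

/-! ### Removing the smoothing -/

section SmoothingInequality

/-- Integrate the minorant equal to `u - w` on `A` and `-δ` off `A`; as `u + δ ≥ 0`, its weight `ν
A` may be lowered to `3 / 4`. -/
lemma le_integral_of_le_on {ν : Measure ℝ} [IsProbabilityMeasure ν] {h : ℝ → ℝ} {A : Set ℝ}
    {u w δ : ℝ} (hA : MeasurableSet A) (hνA : 3 / 4 ≤ ν.real A) (hi : Integrable h ν)
    (hδ : ∀ y, -δ ≤ h y) (hu : -δ ≤ u) (hw : 0 ≤ w) (hAu : ∀ y ∈ A, u - w ≤ h y) :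
    3 / 4 * u - δ / 4 - w ≤ ∫ y, h y ∂ν := by
  have h1 : ∫ y, (A.indicator (fun _ => u - w + δ) y - δ) ∂ν ≤ ∫ y, h y ∂ν := by
    refine integral_mono (((integrable_const _).indicator hA).sub (integrable_const _)) hi
      fun y => ?_
    by_cases hy : y ∈ A
    · simpa [hy] using hAu y hy
    · simpa [hy] using hδ y
  rw [integral_sub ((integrable_const _).indicator hA) (integrable_const _),
    integral_indicator_const _ hA, integral_const] at h1
  simp only [probReal_univ, smul_eq_mul, one_mul] at h1
  have h2 : ν.real A ≤ 1 := measureReal_le_one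
  nlinarith

/-- A smoothing inequality: the uniform distance between a monotone function and a Lipschitz
function is controlled by that between their averages. -/
lemma abs_sub_le_of_abs_convAvg_le {ν : Measure ℝ} [IsProbabilityMeasure ν] {F G : ℝ → ℝ}
    {a L η M : ℝ} (hF : Monotone F) (hG : Measurable G) (ha : 0 ≤ a) (hL : 0 ≤ L)
    (hGL : ∀ x y, x ≤ y → G y - G x ≤ L * (y - x)) (hM : ∀ x, |F x - G x| ≤ M)
    (hν : 3 / 4 ≤ ν.real (Set.Icc (-a) a))
    (hη : ∀ x, |convAvg ν (fun y => F y - G y) x| ≤ η) (x : ℝ) :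
    |F x - G x| ≤ 2 * (η + 2 * a * L) := by
  have mD : Measurable (fun y => F y - G y) := hF.measurable.sub hG
  have bdd : BddAbove (Set.range fun x => |F x - G x|) := ⟨M, by rintro _ ⟨x, rfl⟩; exact hM x⟩
  set δ := ⨆ x, |F x - G x| with hδ
  have hδx (x : ℝ) : |F x - G x| ≤ δ := le_ciSup bdd x
  -- After a shift by `a` to the appropriate side, monotonicity of `F` preserves the gap at `x` over
  -- the whole window `[-a, a]`, up to a Lipschitz loss `2 * a * L`. The mass outside, at most `1 /
  -- 4`, costs at most `δ / 4`; dividing by `3 / 4` gives `δ / 3`, absorbed at the end.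
  have key (x : ℝ) : |F x - G x| ≤ 4 / 3 * (η + 2 * a * L) + δ / 3 := by
    rw [abs_le]
    constructor
    · have h := le_integral_of_le_on (h := fun y => -(F (x - a - y) - G (x - a - y))) (δ := δ)
        (u := -(F x - G x)) (w := 2 * a * L) measurableSet_Icc hν
        (integrable_comp_const_sub mD hM (x - a)).neg
        (fun y => neg_le_neg (abs_le.1 (hδx _)).2) (neg_le_neg (abs_le.1 (hδx _)).2)
        (by positivity) fun y hy => by
          have h1 := hF (show x - a - y ≤ x by linarith [hy.1])
          have h2 := hGL (x - a - y) x (by linarith [hy.1])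
          nlinarith [hy.1, hy.2]
      rw [integral_neg] at h
      have := (abs_le.1 (hη (x - a))).1
      unfold convAvg at this
      linarith
    · have h := le_integral_of_le_on (h := fun y => F (x + a - y) - G (x + a - y)) (δ := δ)
        (u := F x - G x) (w := 2 * a * L) measurableSet_Icc hν
        (integrable_comp_const_sub mD hM (x + a))
        (fun y => (abs_le.1 (hδx _)).1) (abs_le.1 (hδx _)).1
        (by positivity) fun y hy => by
          have h1 := hF (show x ≤ x + a - y by linarith [hy.2])
          have h2 := hGL x (x + a - y) (by linarith [hy.2])
          nlinarith [hy.1, hy.2]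
      have := (abs_le.1 (hη (x + a))).2
      unfold convAvg at this
      linarith
  have : δ ≤ 4 / 3 * (η + 2 * a * L) + δ / 3 := ciSup_le key
  linarith [hδx x]

lemma cdf_gaussianReal_sub_le {v : NNReal} (hv : v ≠ 0) {x y L : ℝ} (hxy : x ≤ y)
    (hL : ∀ z ∈ Set.Ioc x y, gaussianPDFReal 0 v z ≤ L) :
    cdf (gaussianReal 0 v) y - cdf (gaussianReal 0 v) x ≤ L * (y - x) := by
  have e : cdf (gaussianReal 0 v) y - cdf (gaussianReal 0 v) x
      = (gaussianReal 0 v).real (Set.Ioc x y) := by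
    rw [cdf_eq_real, cdf_eq_real, ← measureReal_sdiff (Set.Iic_subset_Iic.2 hxy) measurableSet_Iic]
    congr 1
    ext z
    simp [and_comm]
  rw [e, measureReal_def, gaussianReal_apply_eq_integral _ hv, ENNReal.toReal_ofReal
    (setIntegral_nonneg measurableSet_Ioc fun z _ => gaussianPDFReal_nonneg 0 v z)]
  calc ∫ z in Set.Ioc x y, gaussianPDFReal 0 v z ≤ ∫ _ in Set.Ioc x y, L :=
        setIntegral_mono_on (integrable_gaussianPDFReal 0 v).integrableOn
          (integrableOn_const (by simp)) measurableSet_Ioc hL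
    _ = L * (y - x) := by simp [hxy, mul_comm]

lemma gaussianPDFReal_zero_le {v : NNReal} (z : ℝ) :
    gaussianPDFReal 0 v z ≤ 1 / √(v : ℝ) := by
  rcases eq_or_ne v 0 with rfl | hv
  · simp
  have hv' : 0 < (v : ℝ) := by exact_mod_cast pos_iff_ne_zero.2 hv
  rw [gaussianPDFReal, ← one_div]
  have h1 : Real.exp (-(z - 0) ^ 2 / (2 * v)) ≤ 1 :=
    Real.exp_le_one_iff.2 (div_nonpos_of_nonpos_of_nonneg (by nlinarith [sq_nonneg (z - 0)])
      (by positivity))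
  calc _ ≤ 1 / √(2 * Real.pi * v) * 1 := by gcongr
    _ ≤ 1 / √(v : ℝ) := by
      rw [mul_one]
      gcongr
      nlinarith [Real.pi_gt_three]

/-- Chebyshev's inequality at two standard deviations. -/
lemma three_quarters_le_gaussianReal_Icc {v : NNReal} (hv : v ≠ 0) :
    3 / 4 ≤ (gaussianReal 0 v).real (Set.Icc (-(2 * √(v : ℝ))) (2 * √(v : ℝ))) := by
  have hv' : 0 < (v : ℝ) := by exact_mod_cast pos_iff_ne_zero.2 hv
  have hs := Real.sqrt_pos.2 hv'
  have h := meas_ge_le_variance_div_sq (memLp_id_gaussianReal (μ := 0) (v := v) 2)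
    (c := 2 * √(v : ℝ)) (by positivity)
  rw [variance_id_gaussianReal, mul_pow, Real.sq_sqrt (NNReal.coe_nonneg v)] at h
  simp only [id, integral_id_gaussianReal, sub_zero] at h
  rw [show (v : ℝ) / (2 ^ 2 * v) = 1 / 4 by field_simp; norm_num] at h
  have h2 : (gaussianReal 0 v).real (Set.Icc (-(2 * √(v : ℝ))) (2 * √(v : ℝ)))ᶜ ≤ 1 / 4 := by
    refine ENNReal.toReal_le_of_le_ofReal (by norm_num) (le_trans (measure_mono fun y hy => ?_) h)
    by_contra hc
    exact hy (abs_le.1 (not_le.1 hc).le)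
  rw [probReal_compl_eq_one_sub measurableSet_Icc] at h2
  linarith

end SmoothingInequality

/-! ### The Berry–Esseen theorem by Lindeberg exchange and induction -/

section BerryEsseen

/-- The `n`-fold convolution of `μ` with itself. -/
noncomputable def iterConv (μ : Measure ℝ) : ℕ → Measure ℝ
  | 0 => Measure.dirac 0
  | n + 1 => μ ∗ iterConv μ n

instance isProbabilityMeasure_iterConv (μ : Measure ℝ) [IsProbabilityMeasure μ] (n : ℕ) :
    IsProbabilityMeasure (iterConv μ n) := by
  induction n with
  | zero => unfold iterConv; infer_instance
  | succ n ih => unfold iterConv; infer_instance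

/-- The difference of the distribution functions of the `n`-fold convolution of `μ` and of the
centred normal law with variance `n`. -/
noncomputable def normalGap (μ : Measure ℝ) (n : ℕ) (x : ℝ) : ℝ :=
  cdf (iterConv μ n) x - cdf (gaussianReal 0 n) x

variable {μ : Measure ℝ}

lemma measurable_normalGap (n : ℕ) : Measurable (normalGap μ n) :=
  (measurable_cdf _).sub (measurable_cdf _)

lemma abs_normalGap_le_one (n : ℕ) (x : ℝ) : |normalGap μ n x| ≤ 1 :=
  abs_cdf_sub_cdf_le_one _ _ x

lemma normalGap_zero (x : ℝ) : normalGap μ 0 x = 0 := by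
  simp [normalGap, iterConv, gaussianReal_zero_var]

variable [IsProbabilityMeasure μ]

/-- With `γ_t` the centred normal law of variance `t` and `D_n = μ^{*n} - γ_n`, this is `D_{n+1} =
(μ - γ_1) * D_n + γ_1 * D_n + (μ - γ_1) * γ_n` smoothed by `γ_m`. The middle term is the same
problem with `n` lowered and `m` raised. -/
lemma convAvg_normalGap_succ (m n : ℕ) (x : ℝ) :
    convAvg (gaussianReal 0 m) (normalGap μ (n + 1)) x =
      (convAvg μ (convAvg (gaussianReal 0 m) (normalGap μ n)) x -
        convAvg (gaussianReal 0 1) (convAvg (gaussianReal 0 m) (normalGap μ n)) x) +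
      convAvg (gaussianReal 0 (m + 1 : ℕ)) (normalGap μ n) x +
      (convAvg μ (cdf (gaussianReal 0 (m + n : ℕ))) x -
        convAvg (gaussianReal 0 1) (cdf (gaussianReal 0 (m + n : ℕ))) x) := by
  have hγ (s t : ℕ) : (cdf (gaussianReal 0 (s + t : ℕ)) : ℝ → ℝ) =
      convAvg (gaussianReal 0 s) (cdf (gaussianReal 0 t)) := by
    ext y; rw [Nat.cast_add, ← gaussianReal_zero_conv, cdf_conv]
  have hs : (fun y => cdf (iterConv μ (n + 1)) y) = convAvg μ (cdf (iterConv μ n)) := by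
    ext y; exact cdf_conv y
  have e1 : convAvg (gaussianReal 0 (m + 1 : ℕ)) (normalGap μ n) x =
      convAvg (gaussianReal 0 1) (convAvg (gaussianReal 0 m) (normalGap μ n)) x := by
    rw [add_comm, Nat.cast_add, ← gaussianReal_zero_conv, Nat.cast_one,
      convAvg_conv (measurable_normalGap n) (abs_normalGap_le_one n)]
  have e2 : convAvg (gaussianReal 0 m) (normalGap μ n) = fun y =>
      convAvg (gaussianReal 0 m) (cdf (iterConv μ n)) y - cdf (gaussianReal 0 (m + n : ℕ)) y := by
    ext y
    rw [hγ m n, ← convAvg_sub (measurable_cdf _) (abs_cdf_le_one _) (measurable_cdf _)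
      (abs_cdf_le_one _)]
    rfl
  have e3 : convAvg (gaussianReal 0 1) (cdf (gaussianReal 0 (m + n : ℕ))) x =
      convAvg (gaussianReal 0 m) (cdf (gaussianReal 0 (n + 1 : ℕ))) x := by
    have h := hγ 1 (m + n)
    rw [Nat.cast_one] at h
    rw [← h, ← hγ m (n + 1)]
    congr 4; ring
  have e4 : convAvg (gaussianReal 0 m) (normalGap μ (n + 1)) x =
      convAvg μ (convAvg (gaussianReal 0 m) (cdf (iterConv μ n))) x -
        convAvg (gaussianReal 0 m) (cdf (gaussianReal 0 (n + 1 : ℕ))) x := by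
    rw [convAvg_comm (measurable_cdf _) (abs_cdf_le_one _), ← hs,
      ← convAvg_sub (measurable_cdf _) (abs_cdf_le_one _) (measurable_cdf _) (abs_cdf_le_one _)]
    rfl
  rw [e1, e4, e3]
  have e5 : convAvg μ (convAvg (gaussianReal 0 m) (normalGap μ n)) x =
      convAvg μ (convAvg (gaussianReal 0 m) (cdf (iterConv μ n))) x -
        convAvg μ (cdf (gaussianReal 0 (m + n : ℕ))) x := by
    rw [e2, convAvg_sub (measurable_convAvg (measurable_cdf _))
      (abs_convAvg_le (abs_cdf_le_one _)) (measurable_cdf _) (abs_cdf_le_one _)]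
  rw [e5]
  ring

lemma exists_abs_convAvg_sub_convAvg_gaussianReal_le (hμ3 : MemLp (id : ℝ → ℝ) 3 μ)
    (hmean : ∫ y, y ∂μ = 0) (hsq : ∫ y, y ^ 2 ∂μ = 1) :
    ∃ c : ℝ, 0 ≤ c ∧ ∀ t : ℕ, 0 < t → ∀ (g : ℝ → ℝ) (M : ℝ), Measurable g → (∀ x, |g x| ≤ M) →
      ∀ x, |convAvg μ (convAvg (gaussianReal 0 t) g) x -
        convAvg (gaussianReal 0 1) (convAvg (gaussianReal 0 t) g) x| ≤ c * (M / √(t : ℝ) ^ 3) := by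
  refine ⟨1600 * (∫ y, |y| ^ 3 ∂μ + ∫ y, |y| ^ 3 ∂(gaussianReal 0 1)), by positivity,
    fun t ht g M hg hM x => ?_⟩
  obtain ⟨f₁, f₂, f₃, h0, h1, h2, -, h3⟩ :=
    exists_hasDerivAt_convAvg_gaussianReal (t := t) (by exact_mod_cast ht) hg hM
  have hv : ∫ y, y ^ 2 ∂(gaussianReal 0 1) = 1 := by
    have := variance_id_gaussianReal (μ := 0) (v := 1)
    rw [variance_eq_integral aemeasurable_id] at this
    simpa using this
  refine (abs_convAvg_sub_convAvg_le hμ3 (memLp_id_gaussianReal 3) (by simpa using hmean)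
    (by rw [hsq, hv]) (abs_convAvg_le hM) h0 h1 h2 h3 x).trans (le_of_eq ?_)
  simp
  ring

/-- Iterates `convAvg_normalGap_succ`: when the gap of index `j` is reached, the smoothing variance
has grown to `m + (n - 1 - j)`. The purely normal terms always have total variance `m + n - 1`,
hence the factor `n`. -/
lemma abs_convAvg_normalGap_le {c : ℝ}
    (hc : ∀ t : ℕ, 0 < t → ∀ (g : ℝ → ℝ) (M : ℝ), Measurable g → (∀ x, |g x| ≤ M) →
      ∀ x, |convAvg μ (convAvg (gaussianReal 0 t) g) x -
        convAvg (gaussianReal 0 1) (convAvg (gaussianReal 0 t) g) x| ≤ c * (M / √(t : ℝ) ^ 3))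
    (d : ℕ → ℝ) (n m : ℕ) (hm : 0 < m) (hd : ∀ j < n, ∀ x, |normalGap μ j x| ≤ d j) (x : ℝ) :
    |convAvg (gaussianReal 0 m) (normalGap μ n) x| ≤
      c * ∑ j ∈ Finset.range n, d j / √((m + (n - 1 - j) : ℕ) : ℝ) ^ 3 +
        n * (c * (1 / √((m + n - 1 : ℕ) : ℝ) ^ 3)) := by
  induction n generalizing m with
  | zero =>
    have : normalGap μ 0 = fun _ => 0 := funext normalGap_zero
    simp [this, convAvg]
  | succ n ih =>
    rw [convAvg_normalGap_succ]
    have b1 := hc m hm _ _ (measurable_normalGap n) (hd n (by omega)) x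
    have b2 := ih (m + 1) (by omega) fun j hj => hd j (by omega)
    have b3 : |convAvg μ (cdf (gaussianReal 0 (m + n : ℕ))) x -
        convAvg (gaussianReal 0 1) (cdf (gaussianReal 0 (m + n : ℕ))) x| ≤
        c * (1 / √((m + n : ℕ) : ℝ) ^ 3) := by
      -- The normal distribution function is a smoothed Heaviside function, so `hc` applies with `M
      -- = 1`.
      have e : (cdf (gaussianReal 0 (m + n : ℕ)) : ℝ → ℝ) =
          convAvg (gaussianReal 0 (m + n : ℕ)) (cdf (Measure.dirac 0)) := by
        ext y; rw [← cdf_conv, Measure.conv_dirac_zero]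
      rw [e]
      exact hc (m + n) (by omega) _ 1 (measurable_cdf _) (abs_cdf_le_one _) x
    have e1 : ∑ j ∈ Finset.range n, d j / √((m + 1 + (n - 1 - j) : ℕ) : ℝ) ^ 3 =
        ∑ j ∈ Finset.range n, d j / √((m + (n + 1 - 1 - j) : ℕ) : ℝ) ^ 3 := by
      refine Finset.sum_congr rfl fun j hj => ?_
      rw [show m + 1 + (n - 1 - j) = m + (n + 1 - 1 - j) by
        have := Finset.mem_range.1 hj; omega]
    rw [e1, show m + 1 + n - 1 = m + n by omega] at b2
    rw [Finset.sum_range_succ, show m + (n + 1) - 1 = m + n by omega,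
      show m + (n + 1 - 1 - n) = m by omega]
    refine (abs_add_le _ _).trans ((add_le_add ((abs_add_le _ _).trans
      (add_le_add b1 b2)) b3).trans (le_of_eq ?_))
    push_cast
    ring

lemma sum_one_div_sqrt_pow_three_le {q : ℝ} (hq : 0 < q) (n : ℕ) :
    ∑ i ∈ Finset.range n, 1 / √(q + 1 + i) ^ 3 ≤ 2 / √q := by
  suffices h : ∑ i ∈ Finset.range n, 1 / √(q + 1 + i) ^ 3 ≤ 2 / √q - 2 / √(q + n) from
    h.trans (by linarith [show 0 ≤ 2 / √(q + n) by positivity])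
  induction n with
  | zero => simp
  | succ n ih =>
    rw [Finset.sum_range_succ]
    have hu : 0 < q + n := by positivity
    rw [show q + 1 + (n : ℝ) = (q + n) + 1 by ring, Nat.cast_succ, ← add_assoc]
    set u := q + (n : ℝ)
    have ha := Real.sqrt_pos.2 hu
    have hb : 0 < √(u + 1) := Real.sqrt_pos.2 (by linarith)
    have hab : √u ≤ √(u + 1) := Real.sqrt_le_sqrt (by linarith)
    have ha2 := Real.sq_sqrt hu.le
    have hb2 := Real.sq_sqrt (show 0 ≤ u + 1 by linarith)
    generalize √u = a at *
    generalize √(u + 1) = b at *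
    have e : 2 / a - 2 / b = 2 / (a * b * (a + b)) := by
      field_simp
      nlinarith
    have : 1 / b ^ 3 ≤ 2 / (a * b * (a + b)) := by
      rw [div_le_div_iff₀ (by positivity) (by positivity)]
      have : a * (a + b) ≤ 2 * b ^ 2 := by nlinarith
      nlinarith
    linarith

/-- Split at `j = n / 4`. Above it `d j ≤ 2 * K / √n`, and the inverse powers sum to at most `2 /
√q`; below it the variance is at least `n / 4`, and `d j ≤ 1` suffices. So `K` carries a factor `1 /
√q`, which lets the induction close. -/
lemma sum_div_sqrt_pow_three_le {d : ℕ → ℝ} {K : ℝ} (hK : 0 ≤ K) (hd1 : ∀ j, d j ≤ 1)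
    (hdK : ∀ j, d j ≤ K / √(j : ℝ)) {q n : ℕ} (hq : 0 < q) (hn : 0 < n) :
    ∑ j ∈ Finset.range n, d j / √((q + 1 + (n - 1 - j) : ℕ) : ℝ) ^ 3 ≤
      (4 * K / √(q : ℝ) + 8) / √(n : ℝ) := by
  have hn' : (0 : ℝ) < n := by exact_mod_cast hn
  have hs := Real.sqrt_pos.2 hn'
  have hs2 := Real.sq_sqrt hn'.le
  have hlow {t : ℕ} (ht : n ≤ 4 * t) : √(n : ℝ) / 2 ≤ √(t : ℝ) := by
    refine Real.le_sqrt_of_sq_le ?_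
    have : (n : ℝ) ≤ 4 * t := by exact_mod_cast ht
    rw [div_pow, hs2]; linarith
  have hterm (j : ℕ) (hj : j ∈ Finset.range n) :
      d j / √((q + 1 + (n - 1 - j) : ℕ) : ℝ) ^ 3 ≤
        2 * K / √(n : ℝ) * (1 / √((q : ℝ) + 1 + (n - 1 - j : ℕ)) ^ 3) + 8 / √(n : ℝ) ^ 3 := by
    rw [Finset.mem_range] at hj
    have ht : (0 : ℝ) < (q + 1 + (n - 1 - j) : ℕ) := by positivity
    have hts := Real.sqrt_pos.2 ht
    by_cases hjn : n ≤ 4 * j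
    · have h1 : d j ≤ 2 * K / √(n : ℝ) := by
        refine (hdK j).trans ?_
        have := hlow hjn
        calc K / √(j : ℝ) ≤ K / (√(n : ℝ) / 2) := by gcongr
          _ = 2 * K / √(n : ℝ) := by field_simp
      calc _ ≤ 2 * K / √(n : ℝ) / √((q + 1 + (n - 1 - j) : ℕ) : ℝ) ^ 3 := by gcongr
        _ = 2 * K / √(n : ℝ) * (1 / √((q : ℝ) + 1 + (n - 1 - j : ℕ)) ^ 3) := by
          push_cast; ring
        _ ≤ _ := le_add_of_nonneg_right (by positivity)
    · have := hlow (t := q + 1 + (n - 1 - j)) (by omega)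
      calc _ ≤ 1 / (√(n : ℝ) / 2) ^ 3 := by gcongr; exact hd1 j
        _ = 8 / √(n : ℝ) ^ 3 := by field_simp; norm_num
        _ ≤ _ := le_add_of_nonneg_left (by positivity)
  refine (Finset.sum_le_sum hterm).trans ?_
  rw [Finset.sum_add_distrib, ← Finset.mul_sum,
    Finset.sum_range_reflect (fun i : ℕ => 1 / √((q : ℝ) + 1 + i) ^ 3) n]
  have h1 := sum_one_div_sqrt_pow_three_le (q := q) (by exact_mod_cast hq) n
  have h2 : ∑ _j ∈ Finset.range n, 8 / √(n : ℝ) ^ 3 = 8 / √(n : ℝ) := by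
    rw [Finset.sum_const, Finset.card_range, nsmul_eq_mul]
    field_simp
    rw [hs2]
  rw [h2]
  calc _ ≤ 2 * K / √(n : ℝ) * (2 / √(q : ℝ)) + 8 / √(n : ℝ) := by gcongr
    _ = _ := by ring

/-- The **Berry–Esseen theorem** for a standardized law with a finite third moment. -/
theorem exists_abs_normalGap_le (hμ3 : MemLp (id : ℝ → ℝ) 3 μ)
    (hmean : ∫ y, y ∂μ = 0) (hsq : ∫ y, y ^ 2 ∂μ = 1) :
    ∃ K : ℝ, 0 ≤ K ∧ ∀ (n : ℕ) (x : ℝ), |normalGap μ n x| ≤ K / √(n : ℝ) := by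
  obtain ⟨c, hc0, hc⟩ := exists_abs_convAvg_sub_convAvg_gaussianReal_le hμ3 hmean hsq
  -- This `q` makes `8 * c / √q ≤ 1 / 2`, so the induction hypothesis contributes at most `K / 2`.
  obtain ⟨q, hq⟩ := exists_nat_ge ((16 * c) ^ 2 + 1)
  have hq1 : (1 : ℝ) ≤ q := le_trans (by nlinarith [sq_nonneg (16 * c)]) hq
  have hqpos : 0 < q := by exact_mod_cast lt_of_lt_of_le one_pos hq1
  have hqs : 16 * c ≤ √(q : ℝ) := Real.le_sqrt_of_sq_le (by linarith)
  have hqs0 : 0 < √(q : ℝ) := Real.sqrt_pos.2 (by linarith)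
  -- Twice the part of the final estimate that does not involve `K`.
  set K : ℝ := 2 * (18 * c + 8 * √((q + 1 : ℕ) : ℝ)) with hKdef
  have hK0 : 0 ≤ K := by positivity
  refine ⟨K, hK0, fun n => ?_⟩
  induction n using Nat.strong_induction_on with
  | _ n ih =>
  rcases Nat.eq_zero_or_pos n with rfl | hn
  · simp [normalGap_zero]
  intro x
  have hn' : (0 : ℝ) < n := by exact_mod_cast hn
  have hs := Real.sqrt_pos.2 hn'
  have hη (x : ℝ) : |convAvg (gaussianReal 0 (q + 1 : ℕ)) (normalGap μ n) x| ≤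
      c * ((4 * K / √(q : ℝ) + 8) / √(n : ℝ)) + c / √(n : ℝ) := by
    -- At `j = 0` division by zero makes this bound `0`, consistent with `normalGap_zero`.
    refine (abs_convAvg_normalGap_le hc (fun j => min 1 (K / √(j : ℝ))) n (q + 1) (by omega)
      (fun j hj x => le_min (abs_normalGap_le_one j x) (ih j hj x)) x).trans ?_
    refine add_le_add (mul_le_mul_of_nonneg_left (sum_div_sqrt_pow_three_le hK0
      (fun j => min_le_left _ _) (fun j => min_le_right _ _) hqpos hn) hc0) ?_
    have : √(n : ℝ) ≤ √((q + 1 + n - 1 : ℕ) : ℝ) :=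
      Real.sqrt_le_sqrt (by exact_mod_cast (by omega : n ≤ q + 1 + n - 1))
    calc _ ≤ n * (c * (1 / √(n : ℝ) ^ 3)) := by gcongr
      _ = c / √(n : ℝ) := by
        field_simp
        rw [Real.sq_sqrt hn'.le, mul_comm]
  have h := abs_sub_le_of_abs_convAvg_le (ν := gaussianReal 0 (q + 1 : ℕ))
    (a := 2 * √((q + 1 : ℕ) : ℝ)) (L := 1 / √(n : ℝ))
    (monotone_cdf (iterConv μ n)) (measurable_cdf (gaussianReal 0 n)) (by positivity)
    (by positivity) (fun x y hxy => cdf_gaussianReal_sub_le (by exact_mod_cast hn.ne') hxy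
      fun z _ => by simpa using gaussianPDFReal_zero_le (v := n) z)
    (abs_normalGap_le_one n)
    (by simpa using three_quarters_le_gaussianReal_Icc (v := (q + 1 : ℕ)) (by positivity)) hη x
  refine h.trans ?_
  have h1 : c * (K / √(q : ℝ)) ≤ K / 16 := by
    rw [← mul_div_assoc, div_le_div_iff₀ hqs0 (by norm_num)]
    nlinarith
  have e : 2 * (c * ((4 * K / √(q : ℝ) + 8) / √(n : ℝ)) + c / √(n : ℝ) +
      2 * (2 * √((q + 1 : ℕ) : ℝ)) * (1 / √(n : ℝ))) =
      (8 * (c * (K / √(q : ℝ))) + (18 * c + 8 * √((q + 1 : ℕ) : ℝ))) / √(n : ℝ) := by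
    field_simp
    ring
  rw [e]
  gcongr
  linarith

end BerryEsseen

/-! ### Perturbing the argument of the normal distribution function -/

section StandardNormal

lemma cdf_gaussianReal_eq_stdNormalCDF {k : ℕ} (hk : 0 < k) (u : ℝ) :
    cdf (gaussianReal 0 k) u = stdNormalCDF (u / √(k : ℝ)) := by
  have hs : 0 < √(k : ℝ) := Real.sqrt_pos.2 (by exact_mod_cast hk)
  have e : gaussianReal 0 k = (gaussianReal 0 1).map (√(k : ℝ) * ·) := by
    rw [gaussianReal_map_const_mul]
    congr 1
    · simp
    · ext; simp
  rw [stdNormalCDF, cdf_eq_real, cdf_eq_real, e,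
    map_measureReal_apply (by fun_prop) measurableSet_Iic]
  congr 1
  ext z
  simp [le_div_iff₀ hs, mul_comm]

/-- This crude decay is scale invariant: a relative change of the argument costs only its relative
size. -/
lemma gaussianPDFReal_std_le_inv {z m : ℝ} (hm : 0 < m) (hz : m ≤ |z|) :
    gaussianPDFReal 0 1 z ≤ m⁻¹ := by
  have h1 : (√(2 * Real.pi))⁻¹ ≤ 1 :=
    inv_le_one_of_one_le₀ (Real.one_le_sqrt.2 (by linarith [Real.pi_gt_three]))
  have h2 : Real.exp (-z ^ 2 / 2) ≤ |z|⁻¹ := by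
    rw [neg_div, Real.exp_neg]
    refine inv_anti₀ (hm.trans_le hz) ?_
    have := Real.add_one_le_exp (z ^ 2 / 2)
    nlinarith [sq_nonneg (|z| - 1), sq_abs z]
  calc gaussianPDFReal 0 1 z = (√(2 * Real.pi))⁻¹ * Real.exp (-z ^ 2 / 2) := by
        simp [gaussianPDFReal]
    _ ≤ 1 * |z|⁻¹ := by gcongr
    _ ≤ m⁻¹ := by rw [one_mul]; gcongr

lemma abs_stdNormalCDF_sub_le {a b m : ℝ} (hm : 0 < m) (h : ∀ z ∈ Set.uIcc a b, m ≤ |z|) :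
    |stdNormalCDF a - stdNormalCDF b| ≤ |a - b| / m := by
  wlog hab : a ≤ b generalizing a b
  · rw [abs_sub_comm, abs_sub_comm a b]
    exact this (by rwa [Set.uIcc_comm]) (le_of_not_ge hab)
  have hmono : stdNormalCDF a ≤ stdNormalCDF b := monotone_cdf _ hab
  rw [abs_sub_comm, abs_sub_comm a b, abs_of_nonneg (sub_nonneg.2 hab),
    abs_of_nonneg (sub_nonneg.2 hmono), div_eq_inv_mul]
  exact cdf_gaussianReal_sub_le one_ne_zero hab fun z hz =>
    gaussianPDFReal_std_le_inv hm (h z (Set.Icc_subset_uIcc (Set.Ioc_subset_Icc_self hz)))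

/-- The interval has length `r * |y|` and the density on it is at most `1 / |y|`. -/
lemma abs_stdNormalCDF_mul_sub_le {r : ℝ} (hr : 0 ≤ r) (y : ℝ) :
    |stdNormalCDF ((1 + r) * y) - stdNormalCDF y| ≤ r := by
  rcases eq_or_ne y 0 with rfl | hy
  · simpa using hr
  have hy' := abs_pos.2 hy
  refine (abs_stdNormalCDF_sub_le hy' fun z hz => ?_).trans (le_of_eq ?_)
  · rcases le_total 0 y with h | h
    · rw [Set.uIcc_of_ge (by nlinarith)] at hz
      exact abs_le_abs_of_nonneg h hz.1
    · rw [Set.uIcc_of_le (by nlinarith)] at hz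
      exact abs_le_abs_of_nonpos h hz.2
  · rw [show (1 + r) * y - y = r * y by ring, abs_mul, abs_of_nonneg hr]
    field_simp

/-- As `c * |s| ≥ |s| / 2` and `|x| ≤ |s| / 4`, the interval, of length `(1 - c) * |s|`, stays at
distance `|s| / 4` from the origin. -/
lemma abs_stdNormalCDF_sub_mul_sub_le {x s c M : ℝ} (hx : |x| ≤ M) (hs : s ≠ 0)
    (hMs : 4 * M ≤ |s|) (hc : 1 / 2 ≤ c) (hc1 : c ≤ 1) :
    |stdNormalCDF (x - c * s) - stdNormalCDF (x - s)| ≤ 4 * (1 - c) := by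
  have hs' := abs_pos.2 hs
  have hxM := abs_le.1 hx
  refine (abs_stdNormalCDF_sub_le (m := |s| / 4) (by positivity) fun z hz => ?_).trans
    (le_of_eq ?_)
  · rcases hs.lt_or_gt with h | h
    · rw [abs_of_neg h] at hMs ⊢
      rw [Set.uIcc_of_le (by nlinarith)] at hz
      exact le_trans (by nlinarith [hz.1]) (le_abs_self z)
    · rw [abs_of_pos h] at hMs ⊢
      rw [Set.uIcc_of_ge (by nlinarith)] at hz
      exact le_trans (by nlinarith [hz.2]) (neg_le_abs z)
  · rw [show x - c * s - (x - s) = (1 - c) * s by ring, abs_mul,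
      abs_of_nonneg (sub_nonneg.2 hc1)]
    field_simp

end StandardNormal

/-! ### Adding the contribution of the old sample -/

section Perturbation

/-- Adding an independent centred perturbation to a sum of `k` standardized variables. -/
lemma abs_cdf_iterConv_conv_sub_le {μ ν : Measure ℝ} [IsProbabilityMeasure μ]
    [IsProbabilityMeasure ν] {k : ℕ} {K : ℝ} (hk : 0 < k)
    (hK : ∀ x, |normalGap μ k x| ≤ K / √(k : ℝ))
    (hν : MemLp (id : ℝ → ℝ) 2 ν) (hmean : ∫ y, y ∂ν = 0) (u : ℝ) :
    |cdf (iterConv μ k ∗ ν) u - cdf (gaussianReal 0 k) u| ≤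
      K / √(k : ℝ) + 1600 / k * ∫ y, y ^ 2 ∂ν := by
  -- Again a smoothed Heaviside function; only its second derivative is needed, so two moments of
  -- `ν` suffice.
  have e : (cdf (gaussianReal 0 k) : ℝ → ℝ) =
      convAvg (gaussianReal 0 k) (cdf (Measure.dirac 0)) := by
    ext y; rw [← cdf_conv, Measure.conv_dirac_zero]
  obtain ⟨f₁, f₂, -, h0, h1, -, h2, -⟩ := exists_hasDerivAt_convAvg_gaussianReal (t := k)
    (by exact_mod_cast hk) (measurable_cdf (Measure.dirac 0)) (abs_cdf_le_one _)
  rw [← e] at h0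
  have b1 := abs_convAvg_sub_le hν hmean (abs_cdf_le_one (gaussianReal 0 k)) h0 h1 h2 u
  have b2 := abs_convAvg_le (ν := ν) hK u
  have e2 : convAvg ν (normalGap μ k) u =
      convAvg ν (cdf (iterConv μ k)) u - convAvg ν (cdf (gaussianReal 0 k)) u :=
    convAvg_sub (measurable_cdf _) (abs_cdf_le_one _) (measurable_cdf _) (abs_cdf_le_one _) u
  rw [e2] at b2
  rw [Measure.conv_comm, cdf_conv]
  refine (abs_sub_le _ (convAvg ν (cdf (gaussianReal 0 k)) u) _).trans
    (add_le_add b2 (b1.trans (le_of_eq ?_)))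
  simp

end Perturbation

/-! ### Decomposition of `deltaPlus` and laws of the sums -/

section Sums

variable {Ω : Type*}

/-- Each `X i` has net coefficient `1 / (n + k) - 1 / n = -k / (n * (n + k))`; centring both sums
leaves the drift. -/
lemma deltaPlus_eq (X Y : ℕ → Ω → ℝ) {n k : ℕ} (hn : 0 < n) {μ₀ μ₁ σ₁ : ℝ} (hσ₁ : 0 < σ₁)
    (ω : Ω) :
    deltaPlus X Y n k ω = σ₁ / (n + k) * (∑ j ∈ Finset.range k, (Y j ω - μ₁) / σ₁ +
      -(k / (n * σ₁)) * ∑ i ∈ Finset.range n, (X i ω - μ₀) + k * (μ₁ - μ₀) / σ₁) := by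
  have hn' : (0 : ℝ) < n := by exact_mod_cast hn
  rw [deltaPlus, enlargedMean, sampleMean, ← Finset.sum_div, Finset.sum_sub_distrib,
    Finset.sum_sub_distrib]
  simp only [Finset.sum_const, Finset.card_range, nsmul_eq_mul]
  field_simp
  ring

variable [MeasurableSpace Ω] {P : Measure Ω}

lemma indepFun_sum_range_sum_range {U V : ℕ → Ω → ℝ} (hU : ∀ i, AEMeasurable (U i) P)
    (hV : ∀ j, AEMeasurable (V j) P) (hind : iIndepFun (Sum.elim U V) P) (n k : ℕ) :
    IndepFun (fun ω => ∑ j ∈ Finset.range k, V j ω) (fun ω => ∑ i ∈ Finset.range n, U i ω) P := by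
  classical
  let S : Finset (ℕ ⊕ ℕ) := (Finset.range k).map ⟨Sum.inr, Sum.inr_injective⟩
  let T : Finset (ℕ ⊕ ℕ) := (Finset.range n).map ⟨Sum.inl, Sum.inl_injective⟩
  have hST : Disjoint S T := by
    rw [Finset.disjoint_left]
    intro a ha hb
    obtain ⟨i, -, rfl⟩ := Finset.mem_map.1 ha
    obtain ⟨j, -, h⟩ := Finset.mem_map.1 hb
    simp at h
  have h := (hind.indepFun_finset₀ S T hST (by rintro (i | j); exacts [hU i, hV j])).comp
    (φ := fun v : S → ℝ => ∑ i, v i) (ψ := fun v : T → ℝ => ∑ i, v i) (by fun_prop) (by fun_prop)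
  convert! h using 1
  · ext ω
    simp only [Function.comp_apply]
    rw [Finset.sum_coe_sort S (fun i => Sum.elim U V i ω)]
    simp [S]
  · ext ω
    simp only [Function.comp_apply]
    rw [Finset.sum_coe_sort T (fun i => Sum.elim U V i ω)]
    simp [T]

variable [IsProbabilityMeasure P]

lemma hasLaw_sum_range_iterConv {μ : Measure ℝ} [IsProbabilityMeasure μ] {V : ℕ → Ω → ℝ}
    (hV : ∀ j, HasLaw (V j) μ P) (hind : iIndepFun V P) (k : ℕ) :
    HasLaw (fun ω => ∑ j ∈ Finset.range k, V j ω) (iterConv μ k) P := by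
  induction k with
  | zero => simpa [iterConv] using hasLaw_dirac_of_ae_eq (P := P) (X := fun _ => (0 : ℝ)) (by rfl)
  | succ k ih =>
    simp only [Finset.sum_range_succ, iterConv]
    rw [Measure.conv_comm]
    refine IndepFun.hasLaw_fun_add ih (hV k) ?_
    convert! hind.indepFun_sum_range_succ₀ (fun j => (hV j).aemeasurable) k using 1
    ext ω; simp

end Sums

/-! ### Rates for `k ~ n ^ α` -/

section Rate

lemma eventually_rate_bounds {k : ℕ → ℕ} {α : ℝ}
    (hk : IsEquivalent atTop (fun n : ℕ => (k n : ℝ)) (fun n : ℕ => (n : ℝ) ^ α)) :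
    ∀ᶠ n : ℕ in atTop, 0 < n ∧ 0 < k n ∧
      1 / √(k n : ℝ) ≤ 2 * (n : ℝ) ^ (-(min (α / 2) (1 - α))) ∧
      (k n : ℝ) / n ≤ 2 * (n : ℝ) ^ (-(min (α / 2) (1 - α))) := by
  have hne : ∀ᶠ n : ℕ in atTop, (n : ℝ) ^ α ≠ 0 := by
    filter_upwards [eventually_gt_atTop 0] with n hn
    exact (Real.rpow_pos_of_pos (by exact_mod_cast hn) _).ne'
  have h1 := (isEquivalent_iff_tendsto_one hne).1 hk
  filter_upwards [eventually_gt_atTop 0, h1.eventually_const_le (show (1 / 2 : ℝ) < 1 by norm_num),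
    h1.eventually_le_const (show (1 : ℝ) < 2 by norm_num)] with n hn hlo hhi
  have hn' : (0 : ℝ) < n := by exact_mod_cast hn
  have hn1 : (1 : ℝ) ≤ n := by exact_mod_cast hn
  have hp := Real.rpow_pos_of_pos hn' α
  simp only [Pi.div_apply] at hlo hhi
  rw [le_div_iff₀ hp] at hlo
  rw [div_le_iff₀ hp] at hhi
  have hk0 : (0 : ℝ) < k n := by linarith
  refine ⟨hn, by exact_mod_cast hk0, ?_, ?_⟩
  · have hs : (n : ℝ) ^ (α / 2) / 2 ≤ √(k n : ℝ) := by
      refine Real.le_sqrt_of_sq_le ?_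
      rw [div_pow, ← Real.rpow_natCast, ← Real.rpow_mul hn'.le]
      rw [show α / 2 * (2 : ℕ) = α by push_cast; ring]
      linarith
    have hq := Real.rpow_pos_of_pos hn' (α / 2)
    calc 1 / √(k n : ℝ) ≤ 1 / ((n : ℝ) ^ (α / 2) / 2) := by gcongr
      _ = 2 * (n : ℝ) ^ (-(α / 2)) := by rw [Real.rpow_neg hn'.le]; field_simp
      _ ≤ _ := by
        gcongr
        exact min_le_left _ _
  · calc (k n : ℝ) / n ≤ 2 * (n : ℝ) ^ α / n := by gcongr
      _ = 2 * (n : ℝ) ^ (-(1 - α)) := by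
        rw [neg_sub, Real.rpow_sub hn', Real.rpow_one]; ring
      _ ≤ _ := by
        gcongr
        exact min_le_right _ _

lemma tendsto_sqrt_of_isEquivalent_rpow {k : ℕ → ℕ} {α : ℝ} (hα₀ : 0 < α)
    (hk : IsEquivalent atTop (fun n : ℕ => (k n : ℝ)) (fun n : ℕ => (n : ℝ) ^ α)) :
    Tendsto (fun n => √(k n : ℝ)) atTop atTop :=
  Real.tendsto_sqrt_atTop.comp (hk.symm.tendsto_atTop
    ((tendsto_rpow_atTop hα₀).comp tendsto_natCast_atTop_atTop))

end Rate

/-! ### Finite-sample bound and conclusion -/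

section Main

variable {Ω : Type*} [MeasurableSpace Ω] {P : Measure Ω} [IsProbabilityMeasure P]

lemma integral_sum_sub_eq_zero {F : Measure ℝ} [IsProbabilityMeasure F] {X : ℕ → Ω → ℝ} {m : ℝ}
    (hX : ∀ i, HasLaw (X i) F P) (hF : MemLp (id : ℝ → ℝ) 2 F) (hm : ∫ x, x ∂F = m) (n : ℕ) :
    ∫ ω, ∑ i ∈ Finset.range n, (X i ω - m) ∂P = 0 := by
  have hint (i : ℕ) : Integrable (X i) P := by
    have h : MemLp id 2 (P.map (X i)) := by rwa [(hX i).map_eq]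
    exact ((memLp_map_measure_iff aestronglyMeasurable_id (hX i).aemeasurable).1 h).integrable
      one_le_two
  rw [integral_finsetSum (f := fun i ω => X i ω - m) _ fun i _ => (hint i).sub (integrable_const m)]
  refine Finset.sum_eq_zero fun i _ => ?_
  rw [integral_sub (hint i) (integrable_const m), (hX i).integral_eq, hm]
  simp

lemma memLp_sum_sub {F : Measure ℝ} {X : ℕ → Ω → ℝ} (m : ℝ)
    (hX : ∀ i, HasLaw (X i) F P) (hF : MemLp (id : ℝ → ℝ) 2 F) (i : ℕ) :
    MemLp (fun ω => X i ω - m) 2 P := by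
  have h : MemLp id 2 (P.map (X i)) := by rwa [(hX i).map_eq]
  exact ((memLp_map_measure_iff aestronglyMeasurable_id (hX i).aemeasurable).1 h).sub
    (memLp_const m)

lemma variance_sum_sub {F : Measure ℝ} {X : ℕ → Ω → ℝ} (m : ℝ)
    (hX : ∀ i, HasLaw (X i) F P) (hF : MemLp (id : ℝ → ℝ) 2 F) (hind : iIndepFun X P) (n : ℕ) :
    variance (fun ω => ∑ i ∈ Finset.range n, (X i ω - m)) P = n * variance id F := by
  have h := IndepFun.variance_sum (μ := P) (X := fun i ω => X i ω - m) (s := Finset.range n)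
    (fun i _ => memLp_sum_sub m hX hF i) fun i _ j _ hij =>
      (hind.indepFun hij).comp (φ := fun x => x - m) (ψ := fun x => x - m)
        (by fun_prop) (by fun_prop)
  have e : (fun ω => ∑ i ∈ Finset.range n, (X i ω - m)) =
      ∑ i ∈ Finset.range n, fun ω => X i ω - m := by ext ω; simp
  rw [e, h, Finset.sum_congr rfl fun i _ =>
    (variance_sub_const (hX i).aemeasurable.aestronglyMeasurable m).trans (hX i).variance_eq]
  simp

/-- Normal approximation of the distribution function of `deltaPlus`, for finite sample sizes. -/
lemma exists_abs_Fplus_sub_stdNormalCDF_le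
    {F₀ F₁ : Measure ℝ} [IsProbabilityMeasure F₀] [IsProbabilityMeasure F₁]
    {X Y : ℕ → Ω → ℝ}
    (hX : ∀ i, HasLaw (X i) F₀ P) (hY : ∀ j, HasLaw (Y j) F₁ P)
    (hindep : iIndepFun (Sum.elim X Y) P)
    {μ₀ μ₁ σ₁ : ℝ}
    (hF₀ : MemLp (id : ℝ → ℝ) 2 F₀) (hF₁ : MemLp (id : ℝ → ℝ) 3 F₁)
    (hμ₀ : ∫ x, x ∂F₀ = μ₀) (hμ₁ : ∫ y, y ∂F₁ = μ₁)
    (hσ₁_pos : 0 < σ₁) (hσ₁ : variance (id : ℝ → ℝ) F₁ = σ₁ ^ 2) :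
    ∃ C : ℝ, 0 ≤ C ∧ ∀ n k : ℕ, 0 < n → 0 < k → ∀ x : ℝ,
      |Fplus P X Y n k (√(k : ℝ) * σ₁ * x / n) - stdNormalCDF (x - (n : ℝ) / ((n : ℝ) + (k : ℝ))
          * (√(k : ℝ) * (μ₁ - μ₀) / σ₁))| ≤ C * (1 / √(k : ℝ) + (k : ℝ) / n) := by
  set φ : ℝ → ℝ := fun y => (y - μ₁) / σ₁ with hφ
  have mφ : Measurable φ := by fun_prop
  set μ := F₁.map φ with hμ
  have : IsProbabilityMeasure μ := Measure.isProbabilityMeasure_map mφ.aemeasurable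
  have i1 : Integrable (fun y : ℝ => y) F₁ :=
    memLp_one_iff_integrable.1 (hF₁.mono_exponent (by norm_num))
  have hμ3 : MemLp (id : ℝ → ℝ) 3 μ := by
    rw [hμ, memLp_map_measure_iff aestronglyMeasurable_id mφ.aemeasurable]
    have h := (hF₁.sub (memLp_const μ₁)).mul_const σ₁⁻¹
    refine h.congr_norm mφ.aestronglyMeasurable (ae_of_all _ fun y => ?_)
    simp [hφ, div_eq_mul_inv]
  have hmean : ∫ y, y ∂μ = 0 := by
    rw [hμ, integral_map mφ.aemeasurable (by fun_prop)]
    simp only [hφ]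
    rw [integral_div, integral_sub i1 (integrable_const _), hμ₁]
    simp
  have hsq : ∫ y, y ^ 2 ∂μ = 1 := by
    rw [hμ, integral_map mφ.aemeasurable (by fun_prop)]
    simp only [hφ, div_pow]
    rw [variance_eq_integral aemeasurable_id] at hσ₁
    simp only [id, hμ₁] at hσ₁
    rw [integral_div, hσ₁, div_self (by positivity)]
  obtain ⟨K, hK0, hK⟩ := exists_abs_normalGap_le hμ3 hmean hsq
  have hXind : iIndepFun X P := hindep.precomp (g := Sum.inl) Sum.inl_injective
  have hYind : iIndepFun Y P := hindep.precomp (g := Sum.inr) Sum.inr_injective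
  set v := variance (id : ℝ → ℝ) F₀ with hv
  have hv0 : 0 ≤ v := variance_nonneg _ _
  -- The summands come from Berry–Esseen, from the variance of `W` relative to `k`, and from the
  -- rescaling by `1 + k / n`.
  refine ⟨K + (1600 * v / σ₁ ^ 2 + 1), by positivity, fun n k hn hk x => ?_⟩
  have hn' : (0 : ℝ) < n := by exact_mod_cast hn
  have hk' : (0 : ℝ) < k := by exact_mod_cast hk
  have hsk : 0 < √(k : ℝ) := Real.sqrt_pos.2 hk'
  have hsk2 := Real.sq_sqrt hk'.le
  set b : ℝ := -(k / (n * σ₁)) with hb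
  set V : ℕ → Ω → ℝ := fun j ω => (Y j ω - μ₁) / σ₁
  set T : Ω → ℝ := fun ω => ∑ i ∈ Finset.range n, (X i ω - μ₀) with hT
  set W : Ω → ℝ := fun ω => b * T ω with hW
  have hVlaw (j : ℕ) : HasLaw (V j) μ P :=
    (HasLaw.mk mφ.aemeasurable rfl : HasLaw φ μ F₁).comp (hY j)
  have mT : AEMeasurable T P :=
    Finset.aemeasurable_fun_sum _ fun i _ => (hX i).aemeasurable.sub_const _
  have mW : AEMeasurable W P := mT.const_mul b
  set ν := P.map W with hν
  have : IsProbabilityMeasure ν := Measure.isProbabilityMeasure_map mW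
  have hS := hasLaw_sum_range_iterConv hVlaw
    (hYind.comp (fun _ => φ) (fun _ => mφ)) k
  have hind : IndepFun (fun ω => ∑ j ∈ Finset.range k, V j ω) W P := by
    have h := hindep.comp (Sum.elim (fun _ x => x - μ₀) (fun _ => φ))
      (by rintro (i | j); exacts [measurable_id.sub_const _, mφ])
    have e : (fun i => (Sum.elim (fun _ x => x - μ₀) (fun _ => φ) : ℕ ⊕ ℕ → ℝ → ℝ) i ∘
        (Sum.elim X Y i)) = Sum.elim (fun i ω => X i ω - μ₀) V := by
      ext (i | j) ω <;> rfl
    rw [e] at h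
    exact (indepFun_sum_range_sum_range (fun i => (hX i).aemeasurable.sub_const _)
      (fun j => (hVlaw j).aemeasurable) h n k).comp (φ := id) (ψ := fun y => b * y)
      measurable_id (by fun_prop)
  have hSW := IndepFun.hasLaw_fun_add hS (HasLaw.mk mW rfl : HasLaw W ν P) hind
  have lpT : MemLp T 2 P := memLp_finsetSum _ fun i _ => memLp_sum_sub μ₀ hX hF₀ i
  have hν2 : MemLp (id : ℝ → ℝ) 2 ν := by
    rw [hν, memLp_map_measure_iff aestronglyMeasurable_id mW]
    exact lpT.const_mul b
  have iT : ∫ ω, T ω ∂P = 0 := integral_sum_sub_eq_zero hX hF₀ hμ₀ n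
  have hνmean : ∫ y, y ∂ν = 0 := by
    rw [hν, integral_map mW (by fun_prop)]
    simp only [hW]
    rw [integral_const_mul, iT, mul_zero]
  have hνsq : ∫ y, y ^ 2 ∂ν = b ^ 2 * (n * v) := by
    rw [hν, integral_map mW (by fun_prop), ← variance_sum_sub μ₀ hX hF₀ hXind n,
      variance_eq_integral mT, iT]
    simp only [hW, mul_pow, sub_zero]
    rw [integral_const_mul]
  -- The threshold for the centred sum, obtained by solving the decomposition of `deltaPlus` at the
  -- evaluation point.
  set u : ℝ := (n + k) / n * √(k : ℝ) * x - k * (μ₁ - μ₀) / σ₁ with hu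
  have hF : Fplus P X Y n k (√(k : ℝ) * σ₁ * x / n) = cdf (iterConv μ k ∗ ν) u := by
    have hΔ (ω : Ω) : deltaPlus X Y n k ω = σ₁ / (n + k) *
        (∑ j ∈ Finset.range k, V j ω + W ω + k * (μ₁ - μ₀) / σ₁) :=
      deltaPlus_eq X Y hn hσ₁_pos ω
    have mΔ : AEMeasurable (deltaPlus X Y n k) P := by
      rw [funext hΔ]
      exact (hSW.aemeasurable.add_const _).const_mul _
    have : IsProbabilityMeasure (P.map (deltaPlus X Y n k)) :=
      Measure.isProbabilityMeasure_map mΔ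
    rw [Fplus, cdf_eq_real, cdf_eq_real, ← hSW.map_eq,
      map_measureReal_apply_of_aemeasurable mΔ measurableSet_Iic,
      map_measureReal_apply_of_aemeasurable hSW.aemeasurable measurableSet_Iic]
    congr 1
    ext ω
    simp only [Set.mem_preimage, Set.mem_Iic]
    have e : √(k : ℝ) * σ₁ * x / n = σ₁ / (n + k) * (u + k * (μ₁ - μ₀) / σ₁) := by
      rw [hu]; field_simp; ring
    rw [hΔ, e, mul_le_mul_iff_right₀ (by positivity), add_le_add_iff_right]
  have hmain := abs_cdf_iterConv_conv_sub_le hk (hK k) hν2 hνmean u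
  rw [cdf_gaussianReal_eq_stdNormalCDF hk, hνsq] at hmain
  have hy : u / √(k : ℝ) = (1 + k / n) *
      (x - (n : ℝ) / ((n : ℝ) + (k : ℝ)) * (√(k : ℝ) * (μ₁ - μ₀) / σ₁)) := by
    rw [hu, div_eq_iff hsk.ne']
    field_simp
    linear_combination n * (μ₁ - μ₀) * hsk2
  rw [hy] at hmain
  rw [hF]
  refine (abs_sub_le _ _ _).trans ((add_le_add hmain
    (abs_stdNormalCDF_mul_sub_le (by positivity) _)).trans ?_)
  have e : 1600 / (k : ℝ) * (b ^ 2 * (n * v)) = 1600 * v / σ₁ ^ 2 * (k / n) := by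
    rw [hb]; field_simp
  rw [e, div_eq_mul_one_div K]
  have h1 : 0 ≤ 1 / √(k : ℝ) := by positivity
  have h2 : 0 ≤ (k : ℝ) / n := by positivity
  have h3 : 0 ≤ 1600 * v / σ₁ ^ 2 := by positivity
  nlinarith [mul_nonneg h3 h1, mul_nonneg hK0 h2]

end Main

theorem theorem3 {Ω : Type*} [MeasurableSpace Ω] (P : Measure Ω) [IsProbabilityMeasure P]
    (F₀ F₁ : Measure ℝ) [IsProbabilityMeasure F₀] [IsProbabilityMeasure F₁]
    (X Y : ℕ → Ω → ℝ)
    (hX : ∀ i, HasLaw (X i) F₀ P) (hY : ∀ j, HasLaw (Y j) F₁ P)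
    (hindep : iIndepFun (Sum.elim X Y) P)
    (μ₀ μ₁ σ₀ σ₁ : ℝ)
    (hF₀ : MemLp (id : ℝ → ℝ) 2 F₀) (hF₁ : MemLp (id : ℝ → ℝ) 3 F₁)
    (hμ₀ : ∫ x, x ∂F₀ = μ₀) (hμ₁ : ∫ y, y ∂F₁ = μ₁)
    (hσ₀_nonneg : 0 ≤ σ₀) (hσ₀ : variance (id : ℝ → ℝ) F₀ = σ₀ ^ 2)
    (hσ₁_pos : 0 < σ₁) (hσ₁ : variance (id : ℝ → ℝ) F₁ = σ₁ ^ 2)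
    (α : ℝ) (hα₀ : 0 < α) (hα₁ : α < 1)
    (k : ℕ → ℕ)
    (hk : IsEquivalent atTop (fun n : ℕ => (k n : ℝ)) (fun n : ℕ => (n : ℝ) ^ α)) :
    (∃ C : ℝ, ∀ᶠ n : ℕ in atTop, ∀ x : ℝ,
      |Fplus P X Y n (k n) (Real.sqrt (k n) * σ₁ * x / n)
          - stdNormalCDF (x - (n : ℝ) / ((n : ℝ) + (k n : ℝ))
              * (Real.sqrt (k n) * (μ₁ - μ₀) / σ₁))|
        ≤ C * (n : ℝ) ^ (-(min (α / 2) (1 - α)))) ∧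
    (μ₁ ≠ μ₀ → ∀ M : ℝ, ∃ C : ℝ, ∀ᶠ n : ℕ in atTop, ∀ x : ℝ, |x| ≤ M →
      |Fplus P X Y n (k n) (Real.sqrt (k n) * σ₁ * x / n)
          - stdNormalCDF (x - Real.sqrt (k n) * (μ₁ - μ₀) / σ₁)|
        ≤ C * (n : ℝ) ^ (-(min (α / 2) (1 - α)))) := by
  obtain ⟨C, hC0, hC⟩ :=
    exists_abs_Fplus_sub_stdNormalCDF_le hX hY hindep hF₀ hF₁ hμ₀ hμ₁ hσ₁_pos hσ₁
  have hrate := eventually_rate_bounds hk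
  have h1 : ∀ᶠ n : ℕ in atTop, ∀ x : ℝ,
      |Fplus P X Y n (k n) (Real.sqrt (k n) * σ₁ * x / n)
          - stdNormalCDF (x - (n : ℝ) / ((n : ℝ) + (k n : ℝ))
              * (Real.sqrt (k n) * (μ₁ - μ₀) / σ₁))|
        ≤ 4 * C * (n : ℝ) ^ (-(min (α / 2) (1 - α))) := by
    filter_upwards [hrate] with n ⟨hn, hkn, hr1, hr2⟩ x
    refine (hC n (k n) hn hkn x).trans ?_
    nlinarith
  -- `8 = 4 * 2`: the constant of `abs_stdNormalCDF_sub_mul_sub_le` times that of the bound on `k /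
  -- n`.
  refine ⟨⟨4 * C, h1⟩, fun hne M => ⟨4 * C + 8, ?_⟩⟩
  have hδ : 0 < |μ₁ - μ₀| / σ₁ := div_pos (abs_pos.2 (sub_ne_zero.2 hne)) hσ₁_pos
  -- This forces `k n ≤ n`, hence `n / (n + k n) ≥ 1 / 2`.
  have hsmall : ∀ᶠ n : ℕ in atTop, (n : ℝ) ^ (-(min (α / 2) (1 - α))) ≤ 1 / 2 := by
    have hβ : 0 < min (α / 2) (1 - α) := lt_min (by linarith) (by linarith)
    exact ((tendsto_rpow_neg_atTop hβ).comp tendsto_natCast_atTop_atTop).eventually_le_const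
      (by norm_num)
  filter_upwards [h1, hrate, hsmall,
    ((tendsto_sqrt_of_isEquivalent_rpow hα₀ hk).atTop_mul_const hδ).eventually_ge_atTop (4 * M)]
    with n hn1 ⟨hn, hkn, hr1, hr2⟩ hs hM x hx
  have hn' : (0 : ℝ) < n := by exact_mod_cast hn
  have hkn' : (0 : ℝ) < k n := by exact_mod_cast hkn
  have hkle : (k n : ℝ) ≤ n := by
    have : (k n : ℝ) / n ≤ 1 := by linarith
    rwa [div_le_one hn'] at this
  have habs : |Real.sqrt (k n) * (μ₁ - μ₀) / σ₁| = Real.sqrt (k n) * (|μ₁ - μ₀| / σ₁) := by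
    rw [abs_div, abs_mul, abs_of_nonneg (Real.sqrt_nonneg _), abs_of_pos hσ₁_pos, mul_div_assoc]
  have h2 := abs_stdNormalCDF_sub_mul_sub_le (s := Real.sqrt (k n) * (μ₁ - μ₀) / σ₁)
    (c := (n : ℝ) / ((n : ℝ) + (k n : ℝ))) hx
    (abs_pos.1 (by rw [habs]; exact mul_pos (Real.sqrt_pos.2 hkn') hδ)) (by rwa [habs])
    (by rw [div_le_div_iff₀ (by norm_num) (by positivity)]; linarith)
    (by rw [div_le_one (by positivity)]; linarith)
  have h3 : 1 - (n : ℝ) / ((n : ℝ) + (k n : ℝ)) ≤ (k n : ℝ) / n := by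
    rw [one_sub_div (by positivity), add_sub_cancel_left]
    gcongr
    linarith
  refine (abs_sub_le _ _ _).trans ((add_le_add (hn1 x) h2).trans ?_)
  linarith
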